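/- Let $m\ge 2$. A \emph{body} is a compact set $\Omega\subset\mathbb R^m$ that is the closure of its interior. Its boundary is \emph{piecewise $C^1$} if $\partial\Omega$ is a finite union of sets $\varphi(K)$, where $K\subset\mathbb R^{m-1}$ is compact, equals the closure of its interior and has a boundary of Lebesgue measure zero, and $\varphi$ is a $C^1$ map from a neighbourhood of $K$ to $\mathbb R^m$ that is an injective immersion on the interior of $K$. The body satisfies the \emph{outer cone condition} $(\ast\ast)$ if for every $z\in\partial\Omega$ there are $\varepsilon,\theta>0$ and a unit vector $u$ such that every $y\ne z$ with $|y-z|<\varepsilon$ and $\angle(y-z,u)<\theta$ lies in $\Omega^c$. Let $A(S^{m-1})=2\pi^{m/2}/\Gamma(m/2)$ and $\alpha\in\mathbb R$. If $\alpha>0$ or $x\notin\Omega$, put $V^{(\alpha)}_\Omega(x)=\int_\Omega|x-y|^{\alpha-m}\,dy$. If $\alpha\le 0$ and $x$ is an interior point of $\Omega$, put $$V^{(\alpha)}_\Omega(x)=\lim_{\varepsilon\to+0}\Big(\int_{\Omega\setminus B_\varepsilon(x)}|x-y|^{\alpha-m}\,dy-c_\alpha(\varepsilon)\Big),$$ where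 $c_\alpha(\varepsilon)=\frac{A(S^{m-1})}{-\alpha}\,\varepsilon^{\alpha}$ if $\alpha<0$ and $c_0(\varepsilon)=A(S^{m-1})\log\frac1\varepsilon$. Put $V^{\log}_\Omega(x)=\int_\Omega\log\frac1{|x-y|}\,dy$. An \emph{$r^{\alpha-m}$-center} of $\Omega$ is a point of $\mathbb R^m$ at which $V^{(\alpha)}_\Omega$ attains its minimum over $\mathbb R^m$ if $\alpha>m$, at which $V^{\log}_\Omega$ attains its maximum over $\mathbb R^m$ if $\alpha=m$, at which $V^{(\alpha)}_\Omega$ attains its maximum over $\mathbb R^m$ if $0<\alpha<m$, and a point of the interior of $\Omega$ at which the restriction of $V^{(\alpha)}_\Omega$ to the interior of $\Omega$ attains its maximum if $\alpha\le0$. For a unit vector $v$ and $b\in\mathbb R$ let $M_v=\sup_{x\in\Omega}x\cdot v$, let $\Omega^+_{v,b}=\{x\in\Omega: x\cdot v>b\}$, let $\mathrm{Refl}_{v,b}$ be the reflection in the hyperplane $\{x: x\cdot v=b\}$, and let $$l_v=\inf\{a\le M_v:\ \mathrm{Refl}_{v,b}(\Omega^+_{v,b})\subset\Omega\ \text{ for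 all } b \text{ with } a\le b\le M_v\}.$$ The \emph{minimal unfolded region} is $Uf(\Omega)=\bigcap_{|v|=1}\{x\in\mathbb R^m: x\cdot v\le l_v\}$. \textbf{Theorem.} Let $m\ge2$, let $\Omega\subset\mathbb R^m$ be a non-empty body with piecewise $C^1$ boundary, and let $\alpha\in\mathbb R$. Then all integrals and limits in the above definitions of $V^{(\alpha)}_\Omega$ and $V^{\log}_\Omega$ exist and are finite, and: (1) if $\alpha>0$, or if $\alpha\le0$ and $\Omega$ satisfies the outer cone condition $(\ast\ast)$, then $\Omega$ has an $r^{\alpha-m}$-center; (2) every $r^{\alpha-m}$-center of $\Omega$ lies in $Uf(\Omega)$. In particular, a non-empty body with piecewise $C^1$ boundary that satisfies $(\ast\ast)$ has an $r^{\alpha-m}$-center in $Uf(\Omega)$ for every $\alpha$. -/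

import Mathlib

open MeasureTheory Filter Topology Set

noncomputable section

namespace RieszCenter

/-- Euclidean space of dimension `m`, with its Euclidean norm and Lebesgue measure. -/
abbrev E (m : ℕ) : Type := EuclideanSpace ℝ (Fin m)

/-! ### Bodies, piecewise `C¹` boundaries, the outer cone condition -/

/-- A body: a compact set which is the closure of its interior. -/
def IsBody {m : ℕ} (Ω : Set (E m)) : Prop :=
  IsCompact Ω ∧ closure (interior Ω) = Ω

/-- A compact `C¹` hypersurface piece: the image of a compact parameter domain `K` in dimension
`m - 1` (the closure of its interior, with negligible boundary) under a map that is `C¹` on a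
neighbourhood of `K` and is an injective immersion on the interior of `K`. Degeneration on the
boundary of `K` is allowed. -/
def IsC1Piece {m : ℕ} (S : Set (E m)) : Prop :=
  ∃ (K U : Set (E (m - 1))) (φ : E (m - 1) → E m),
    IsCompact K ∧ closure (interior K) = K ∧ volume (frontier K) = 0 ∧
    IsOpen U ∧ K ⊆ U ∧ ContDiffOn ℝ 1 φ U ∧
    InjOn φ (interior K) ∧ (∀ p ∈ interior K, Function.Injective (fderiv ℝ φ p)) ∧
    φ '' K = S

/-- The boundary of `Ω` is a finite union of compact `C¹` hypersurface pieces. -/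
def HasPiecewiseC1Boundary {m : ℕ} (Ω : Set (E m)) : Prop :=
  ∃ F : Set (Set (E m)), F.Finite ∧ (∀ S ∈ F, IsC1Piece S) ∧ frontier Ω = ⋃₀ F

/-- The truncated cone of revolution with vertex `z`, axis direction `u`, height `ε` and cone
angle `θ`; the vertex itself is left out. -/
def truncatedCone {m : ℕ} (z u : E m) (ε θ : ℝ) : Set (E m) :=
  {y | y ≠ z ∧ dist y z < ε ∧ InnerProductGeometry.angle (y - z) u < θ}

/-- The outer cone condition (Poincaré's condition outside): every boundary point is the vertex of
a truncated cone of revolution in the complement of `Ω`. The size of the cone may depend on the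
boundary point. -/
def OuterConeCondition {m : ℕ} (Ω : Set (E m)) : Prop :=
  ∀ z ∈ frontier Ω, ∃ ε > 0, ∃ θ > 0, ∃ u : E m, ‖u‖ = 1 ∧ truncatedCone z u ε θ ⊆ Ωᶜ

/-! ### Potentials -/

/-- The volume of the unit sphere of dimension `m - 1`. -/
def sphereArea (m : ℕ) : ℝ := 2 * Real.pi ^ ((m : ℝ) / 2) / Real.Gamma ((m : ℝ) / 2)

/-- The term that is subtracted from the integral outside an `ε`-ball, for `α ≤ 0`. -/
def divergentTerm (m : ℕ) (α ε : ℝ) : ℝ :=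
  if α = 0 then sphereArea m * Real.log (1 / ε)
  else sphereArea m / (-α) * (1 / ε ^ (-α))

/-- The kernel `|x - y| ^ (α - m)` as a function of `y`. -/
def kernel {m : ℕ} (α : ℝ) (x y : E m) : ℝ := dist x y ^ (α - (m : ℝ))

/-- The expression whose limit as `ε → 0+` is the renormalized potential. -/
def truncatedPotential {m : ℕ} (α : ℝ) (Ω : Set (E m)) (x : E m) (ε : ℝ) : ℝ :=
  (∫ y in Ω \ Metric.ball x ε, kernel α x y) - divergentTerm m α ε

open scoped Classical in
/-- The (renormalized) `r ^ (α - m)`-potential of `Ω`. Its value carries no meaning if `α ≤ 0` and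
`x` is a boundary point of `Ω`. -/
def potential {m : ℕ} (α : ℝ) (Ω : Set (E m)) (x : E m) : ℝ :=
  if α ≤ 0 ∧ x ∈ interior Ω then limUnder (𝓝[>] (0 : ℝ)) (truncatedPotential α Ω x)
  else ∫ y in Ω, kernel α x y

/-- The log potential of `Ω`. -/
def logPotential {m : ℕ} (Ω : Set (E m)) (x : E m) : ℝ :=
  ∫ y in Ω, Real.log (1 / dist x y)

/-- All integrals and limits in the definitions of the potentials exist: for `α > 0` at every
point, for `α ≤ 0` at every interior point and every exterior point. -/
def PotentialsWellDefined {m : ℕ} (α : ℝ) (Ω : Set (E m)) : Prop :=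
  (∀ x, 0 < α ∨ x ∉ Ω → IntegrableOn (kernel α x) Ω) ∧
  (α ≤ 0 → ∀ x ∈ interior Ω,
    (∀ ε > 0, IntegrableOn (kernel α x) (Ω \ Metric.ball x ε)) ∧
    ∃ L : ℝ, Tendsto (truncatedPotential α Ω x) (𝓝[>] 0) (𝓝 L)) ∧
  (∀ x, IntegrableOn (fun y => Real.log (1 / dist x y)) Ω)

/-! ### Centers and the minimal unfolded region -/

/-- `x` is an `r ^ (α - m)`-center of `Ω`: a minimum point of the potential if `α > m`, a maximum
point of the log potential if `α = m`, a maximum point of the potential if `0 < α < m`, and a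
maximum point of its restriction to the interior of `Ω` if `α ≤ 0`. -/
structure IsCenter {m : ℕ} (α : ℝ) (Ω : Set (E m)) (x : E m) : Prop where
  of_gt : (m : ℝ) < α → ∀ y, potential α Ω x ≤ potential α Ω y
  of_eq : α = (m : ℝ) → ∀ y, logPotential Ω y ≤ logPotential Ω x
  of_lt : 0 < α → α < (m : ℝ) → ∀ y, potential α Ω y ≤ potential α Ω x
  of_nonpos : α ≤ 0 →
    x ∈ interior Ω ∧ ∀ y ∈ interior Ω, potential α Ω y ≤ potential α Ω x

/-- For a unit vector `v`, the reflection in the hyperplane `{x | ⟪x, v⟫ = b}`. -/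
def refl {m : ℕ} (v : E m) (b : ℝ) (x : E m) : E m := x - (2 * (inner ℝ x v - b)) • v

/-- The support value `M_v`. -/
def supportValue {m : ℕ} (Ω : Set (E m)) (v : E m) : ℝ := sSup ((fun x => inner ℝ x v) '' Ω)

/-- The cap of `Ω` cut off by the hyperplane `{x | ⟪x, v⟫ = b}`. -/
def cap {m : ℕ} (Ω : Set (E m)) (v : E m) (b : ℝ) : Set (E m) := {x ∈ Ω | b < inner ℝ x v}

/-- The level `l_v` of the maximal cap in direction `v`. -/
def foldingLevel {m : ℕ} (Ω : Set (E m)) (v : E m) : ℝ :=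
  sInf {a | a ≤ supportValue Ω v ∧
    ∀ b, a ≤ b → b ≤ supportValue Ω v → refl v b '' cap Ω v b ⊆ Ω}

/-- The minimal unfolded region of `Ω`. -/
def minimalUnfoldedRegion {m : ℕ} (Ω : Set (E m)) : Set (E m) :=
  {x | ∀ v : E m, ‖v‖ = 1 → inner ℝ x v ≤ foldingLevel Ω v}

end RieszCenter

end

noncomputable section

namespace RieszCenter

/-! ### Reflections -/

/-! Location of centers: this is the moving plane argument. If `x` lies beyond the folding level in
direction `v`, some hyperplane with `x` strictly on its cap side folds the cap into `Ω` and leaves a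
remainder of positive measure strictly on the other side (`exists_fold_of_foldingLevel_lt`). The cap
and its mirror image together contribute equally to the potentials at `x` and at its mirror image.
The mirror image is nearer to the rest of `Ω`, so a strictly decreasing kernel gives it a strictly
larger potential, and `x` is not a center. For `α ≤ 0` a cutoff around the two points makes the same
comparison meaningful (`potential_lt_potential_refl`).

Existence: up to a constant, the potential is minus the integral of the kernel over the part of a
large ball around `x` that lies outside `Ω`, the `deficit`. By Fatou's lemma the deficit is lower
semicontinuous, even where it is infinite, so it has minimum points on compact sets. For integrable
kernels a large ball suffices, since far away points do worse than the origin. For `α ≤ 0` the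
deficit is minimized over `Ω`: it is finite in the interior, while an outer cone makes it infinite
at a boundary point, because `|w| ^ (-m)` has infinite integral over every truncated cone.

The renormalized limit exists because the subtracted term is, up to sign, an antiderivative of the
radial density of the kernel: once the ball lies in `Ω`, the truncated potential no longer depends
on its radius. -/

theorem inner_self_eq_one {m : ℕ} {v : E m} (hv : ‖v‖ = 1) : inner ℝ v v = (1 : ℝ) := by
  rw [real_inner_self_eq_norm_sq, hv, one_pow]

theorem inner_refl {m : ℕ} {v : E m} (hv : ‖v‖ = 1) (b : ℝ) (x : E m) :
    inner ℝ (refl v b x) v = 2 * b - inner ℝ x v := by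
  rw [refl, inner_sub_left, real_inner_smul_left, inner_self_eq_one hv]
  ring

theorem refl_refl {m : ℕ} {v : E m} (hv : ‖v‖ = 1) (b : ℝ) (x : E m) :
    refl v b (refl v b x) = x := by
  conv_lhs => rw [refl, inner_refl hv, refl]
  rw [sub_sub, ← add_smul, show 2 * (inner ℝ x v - b) + 2 * (2 * b - inner ℝ x v - b) = 0 by ring]
  simp

theorem dist_sq_refl_left {m : ℕ} {v : E m} (hv : ‖v‖ = 1) (b : ℝ) (x y : E m) :
    dist (refl v b x) y ^ 2 =
      dist x y ^ 2 - 4 * (inner ℝ x v - b) * (b - inner ℝ y v) := by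
  have h : refl v b x - y = (x - y) - (2 * (inner ℝ x v - b)) • v := by
    rw [refl]; abel
  rw [dist_eq_norm, dist_eq_norm, h, norm_sub_sq_real, norm_smul, hv, real_inner_smul_right,
    inner_sub_left, Real.norm_eq_abs, mul_one, sq_abs]
  ring

theorem dist_refl_left {m : ℕ} {v : E m} (hv : ‖v‖ = 1) (b : ℝ) (x y : E m) :
    dist (refl v b x) y = dist x (refl v b y) := by
  rw [← sq_eq_sq₀ dist_nonneg dist_nonneg, dist_sq_refl_left hv, dist_comm x (refl v b y),
    dist_sq_refl_left hv, dist_comm x y]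
  ring

theorem dist_refl_left_le {m : ℕ} {v : E m} (hv : ‖v‖ = 1) {b : ℝ} {x y : E m}
    (hx : b < inner ℝ x v) (hy : inner ℝ y v ≤ b) : dist (refl v b x) y ≤ dist x y := by
  rw [← sq_le_sq₀ dist_nonneg dist_nonneg, dist_sq_refl_left hv]
  nlinarith [mul_nonneg (sub_nonneg.2 hx.le) (sub_nonneg.2 hy)]

theorem dist_refl_left_lt {m : ℕ} {v : E m} (hv : ‖v‖ = 1) {b : ℝ} {x y : E m}
    (hx : b < inner ℝ x v) (hy : inner ℝ y v < b) : dist (refl v b x) y < dist x y := by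
  rw [← sq_lt_sq₀ dist_nonneg dist_nonneg, dist_sq_refl_left hv]
  nlinarith [mul_pos (sub_pos.2 hx) (sub_pos.2 hy)]

theorem continuous_refl {m : ℕ} (v : E m) (b : ℝ) : Continuous (refl v b) := by
  unfold refl
  fun_prop

/-- The reflection in a hyperplane as a homeomorphism. -/
def reflHomeomorph {m : ℕ} (v : E m) (hv : ‖v‖ = 1) (b : ℝ) : E m ≃ₜ E m where
  toFun := refl v b
  invFun := refl v b
  left_inv := refl_refl hv b
  right_inv := refl_refl hv b
  continuous_toFun := continuous_refl v b
  continuous_invFun := continuous_refl v b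

theorem measurePreserving_refl {m : ℕ} {v : E m} (hv : ‖v‖ = 1) (b : ℝ) :
    MeasurePreserving (refl v b) volume volume := by
  have h : refl v b = (fun y => y + (2 * b) • v) ∘ ((ℝ ∙ v)ᗮ).reflection := by
    ext1 x
    rw [Function.comp_apply, Submodule.reflection_orthogonal_apply,
      Submodule.reflection_singleton_apply, refl, hv, real_inner_comm]
    simp only [RCLike.ofReal_real_eq_id, id, one_pow, div_one, smul_smul, ← Nat.cast_smul_eq_nsmul ℝ]
    module
  rw [h]
  exact (measurePreserving_add_right volume _).comp
    ((ℝ ∙ v)ᗮ).reflection.measurePreserving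

theorem measurableEmbedding_refl {m : ℕ} {v : E m} (hv : ‖v‖ = 1) (b : ℝ) :
    MeasurableEmbedding (refl v b) :=
  (reflHomeomorph v hv b).measurableEmbedding

/-! ### Folding along a hyperplane -/

/-- The points of `Ω` that are neither in the cap nor in its reflection. -/
def foldRemainder {m : ℕ} (Ω : Set (E m)) (v : E m) (b : ℝ) : Set (E m) :=
  {y ∈ Ω | inner ℝ y v ≤ b ∧ refl v b y ∉ cap Ω v b}

theorem measurable_inner_right {m : ℕ} (v : E m) : Measurable fun y : E m => inner ℝ y v := by
  fun_prop

theorem measurableSet_cap {m : ℕ} {Ω : Set (E m)} (hΩ : MeasurableSet Ω) (v : E m) (b : ℝ) :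
    MeasurableSet (cap Ω v b) :=
  hΩ.inter (measurableSet_lt measurable_const (measurable_inner_right v))

theorem measurableSet_foldRemainder {m : ℕ} {Ω : Set (E m)} (hΩ : MeasurableSet Ω) (v : E m)
    (b : ℝ) : MeasurableSet (foldRemainder Ω v b) :=
  hΩ.inter (MeasurableSet.inter (measurableSet_le (measurable_inner_right v) measurable_const)
    ((continuous_refl v b).measurable (measurableSet_cap hΩ v b)).compl)

theorem foldRemainder_subset {m : ℕ} (Ω : Set (E m)) (v : E m) (b : ℝ) :
    foldRemainder Ω v b ⊆ Ω := fun _ h => h.1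

/-- What is left after removing the remainder is exactly the cap together with its mirror image.
Points on the hyperplane itself belong to the remainder. -/
theorem preimage_refl_diff_foldRemainder {m : ℕ} {Ω : Set (E m)} {v : E m} (hv : ‖v‖ = 1) {b : ℝ}
    (hfold : refl v b '' cap Ω v b ⊆ Ω) :
    refl v b ⁻¹' (Ω \ foldRemainder Ω v b) = Ω \ foldRemainder Ω v b := by
  have key : ∀ y ∈ Ω \ foldRemainder Ω v b, refl v b y ∈ Ω \ foldRemainder Ω v b := by
    rintro y ⟨hy, hn⟩
    rcases lt_or_ge b (inner ℝ y v) with h | h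
    · exact ⟨hfold ⟨y, ⟨hy, h⟩, rfl⟩, fun h' => h'.2.2 (by rw [refl_refl hv]; exact ⟨hy, h⟩)⟩
    · have hc : refl v b y ∈ cap Ω v b := by
        by_contra hc
        exact hn ⟨hy, h, hc⟩
      exact ⟨hc.1, fun h' => (h'.2.1.trans_lt hc.2).false⟩
  refine Subset.antisymm (fun y hy => ?_) key
  rw [← refl_refl hv b y]
  exact key _ hy

/-- The reflection preserves volume and moves from one argument of the distance to the other, so the
symmetric part of `Ω` contributes equally to both integrals and cancels. -/
theorem setIntegral_refl_sub_setIntegral {m : ℕ} {Ω : Set (E m)} (hΩ : MeasurableSet Ω) {v : E m}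
    (hv : ‖v‖ = 1) {b : ℝ} (hfold : refl v b '' cap Ω v b ⊆ Ω) (x : E m) (φ : ℝ → ℝ)
    (hi : IntegrableOn (fun y => φ (dist x y)) Ω)
    (hi' : IntegrableOn (fun y => φ (dist (refl v b x) y)) Ω) :
    (∫ y in Ω, φ (dist (refl v b x) y)) - ∫ y in Ω, φ (dist x y) =
      ∫ y in foldRemainder Ω v b, (φ (dist (refl v b x) y) - φ (dist x y)) := by
  have hm := measurableSet_foldRemainder hΩ v b
  have hs := foldRemainder_subset Ω v b
  have h := (measurePreserving_refl hv b).setIntegral_preimage_emb (measurableEmbedding_refl hv b)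
    (fun y => φ (dist x y)) (Ω \ foldRemainder Ω v b)
  rw [preimage_refl_diff_foldRemainder hv hfold] at h
  simp only [← dist_refl_left hv] at h
  rw [integral_sub (hi'.mono_set hs) (hi.mono_set hs)]
  rw [setIntegral_sdiff hm hi hs, setIntegral_sdiff hm hi' hs] at h
  linarith

theorem setIntegral_foldRemainder_pos {m : ℕ} [Nonempty (Fin m)] {Ω : Set (E m)}
    (hΩ : MeasurableSet Ω) {v : E m}
    (hv : ‖v‖ = 1) {b : ℝ} {x : E m} (hx : b < inner ℝ x v) {φ : ℝ → ℝ}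
    (hφ : StrictAntiOn φ (Ioi 0))
    (hpos : 0 < volume (foldRemainder Ω v b ∩ {y | inner ℝ y v < b}))
    (hi : IntegrableOn (fun y => φ (dist (refl v b x) y) - φ (dist x y)) (foldRemainder Ω v b)) :
    0 < ∫ y in foldRemainder Ω v b, (φ (dist (refl v b x) y) - φ (dist x y)) := by
  have hm := measurableSet_foldRemainder hΩ v b
  -- Monotonicity of `φ` is known only on positive distances, so the single point at distance `0`
  -- from the mirror image is discarded.
  have hne : ∀ᵐ y : E m, y ≠ refl v b x := by simp [ae_iff]
  rw [setIntegral_pos_iff_support_of_nonneg_ae _ hi]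
  · refine hpos.trans_le (measure_mono_ae ?_)
    filter_upwards [hne] with y hy h
    have hd : 0 < dist (refl v b x) y := dist_pos.2 hy.symm
    have hlt := dist_refl_left_lt hv hx h.2
    exact ⟨(sub_pos.2 (hφ hd (hd.trans hlt) hlt)).ne', h.1⟩
  · filter_upwards [ae_restrict_of_ae hne, ae_restrict_mem hm] with y hy h
    have hd : 0 < dist (refl v b x) y := dist_pos.2 hy.symm
    have hle := dist_refl_left_le hv hx h.2.1
    exact sub_nonneg.2 (hφ.antitoneOn hd (hd.trans_le hle) hle)

/-- The interior points below the hyperplane whose mirror images miss `Ω` form an open subset of a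
null set, so there are none. The fold handles the points above, and taking closures recovers the
hyperplane and the boundary. -/
theorem refl_mem_of_volume_foldRemainder_eq_zero {m : ℕ} {Ω : Set (E m)} (hΩ : IsBody Ω)
    {v : E m} (hv : ‖v‖ = 1) {b : ℝ} (hfold : refl v b '' cap Ω v b ⊆ Ω)
    (h0 : volume (foldRemainder Ω v b ∩ {y | inner ℝ y v < b}) = 0) {y : E m} (hy : y ∈ Ω) :
    refl v b y ∈ Ω := by
  have hcl : IsClosed (refl v b ⁻¹' Ω) := hΩ.1.isClosed.preimage (continuous_refl v b)
  have hplane : Dense {y : E m | inner ℝ y v ≠ b} := by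
    intro z
    by_cases hz : inner ℝ z v = b
    · refine mem_closure_of_tendsto (f := fun t : ℝ => z + t • v) (b := 𝓝[≠] (0 : ℝ)) ?_ ?_
      · have : Continuous fun t : ℝ => z + t • v := by fun_prop
        simpa using (this.tendsto 0).mono_left nhdsWithin_le_nhds
      · filter_upwards [self_mem_nhdsWithin] with t ht
        simpa [inner_add_left, real_inner_smul_left, hz, hv] using ht
    · exact subset_closure hz
  have hU : interior Ω ∩ {y | inner ℝ y v < b} ⊆ refl v b ⁻¹' Ω := by
    have hopen : IsOpen ((interior Ω ∩ {y | inner ℝ y v < b}) \ refl v b ⁻¹' Ω) :=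
      (isOpen_interior.inter (isOpen_lt (by fun_prop) continuous_const)).sdiff hcl
    have : (interior Ω ∩ {y | inner ℝ y v < b}) \ refl v b ⁻¹' Ω = ∅ := by
      by_contra hne
      refine (hopen.measure_pos volume (nonempty_iff_ne_empty.2 hne)).ne' (measure_mono_null ?_ h0)
      rintro z ⟨⟨hz, hzb⟩, hzn⟩
      exact ⟨⟨interior_subset hz, le_of_lt hzb, fun h => hzn h.1⟩, hzb⟩
    exact sdiff_eq_empty.1 this
  have hsub : interior Ω ∩ {y | inner ℝ y v ≠ b} ⊆ refl v b ⁻¹' Ω := by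
    rintro z ⟨hz, hzb⟩
    rcases lt_or_gt_of_ne hzb with h | h
    · exact hU ⟨hz, h⟩
    · exact hfold ⟨z, ⟨interior_subset hz, h⟩, rfl⟩
  have : Ω ⊆ refl v b ⁻¹' Ω := by
    conv_lhs => rw [← hΩ.2]
    refine closure_minimal ?_ hcl
    exact (hplane.open_subset_closure_inter isOpen_interior).trans (closure_minimal hsub hcl)
  exact this hy

theorem inner_le_supportValue {m : ℕ} {Ω : Set (E m)} (hΩ : IsCompact Ω) (v : E m) {x : E m}
    (hx : x ∈ Ω) : inner ℝ x v ≤ supportValue Ω v :=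
  le_csSup (hΩ.image (by fun_prop : Continuous fun x : E m => inner ℝ x v)).bddAbove ⟨x, hx, rfl⟩

theorem exists_inner_eq_supportValue {m : ℕ} {Ω : Set (E m)} (hΩ : IsCompact Ω)
    (hne : Ω.Nonempty) (v : E m) : ∃ x ∈ Ω, inner ℝ x v = supportValue Ω v :=
  (hΩ.image (by fun_prop : Continuous fun x : E m => inner ℝ x v)).sSup_mem (hne.image _)

theorem cap_eq_empty {m : ℕ} {Ω : Set (E m)} (hΩ : IsCompact Ω) {v : E m} {b : ℝ}
    (hb : supportValue Ω v ≤ b) : cap Ω v b = ∅ := by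
  refine eq_empty_of_forall_notMem fun y hy => ?_
  exact ((inner_le_supportValue hΩ v hy.1).trans hb).not_gt hy.2

/-- Beyond the folding level there is a hyperplane along which the cap can be folded into `Ω`
without covering the other side. -/
theorem exists_fold_of_foldingLevel_lt {m : ℕ} {Ω : Set (E m)} (hΩ : IsBody Ω) (hne : Ω.Nonempty)
    {v : E m} (hv : ‖v‖ = 1) {x : E m} (hx : foldingLevel Ω v < inner ℝ x v) :
    ∃ b < inner ℝ x v, refl v b '' cap Ω v b ⊆ Ω ∧
      0 < volume (foldRemainder Ω v b ∩ {y | inner ℝ y v < b}) := by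
  obtain ⟨a, ⟨haM, ha⟩, hax⟩ := exists_lt_of_csInf_lt
    (s := {a | a ≤ supportValue Ω v ∧
      ∀ b, a ≤ b → b ≤ supportValue Ω v → refl v b '' cap Ω v b ⊆ Ω})
    ⟨supportValue Ω v, le_rfl, fun b hb hb' => by
      simp [cap_eq_empty hΩ.1 hb]⟩ hx
  obtain ⟨p, hp, hpM⟩ := exists_inner_eq_supportValue hΩ.1 hne v
  have hfold : ∀ b, a ≤ b → refl v b '' cap Ω v b ⊆ Ω := by
    intro b hb
    rcases le_total b (supportValue Ω v) with h | h
    · exact ha b hb h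
    · simp [cap_eq_empty hΩ.1 h]
  -- Two levels are needed: if both failed, `Ω` would be symmetric in two parallel hyperplanes,
  -- hence mapped into itself by the translation by `2 * (b₂ - b₁)` along `v`. This would push the
  -- support point `p` beyond the support value.
  obtain ⟨b₁, h₁, hb₁⟩ := exists_between hax
  obtain ⟨b₂, h₂, hb₂⟩ := exists_between hb₁
  by_contra! hcon
  have e₁ := hcon b₁ hb₁ (hfold b₁ h₁.le)
  have e₂ := hcon b₂ hb₂ (hfold b₂ (h₁.trans h₂).le)
  have q := refl_mem_of_volume_foldRemainder_eq_zero hΩ hv (hfold b₁ h₁.le) (nonpos_iff_eq_zero.1 e₁) hp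
  have r := refl_mem_of_volume_foldRemainder_eq_zero hΩ hv (hfold b₂ (h₁.trans h₂).le)
    (nonpos_iff_eq_zero.1 e₂) q
  have := inner_le_supportValue hΩ.1 v r
  rw [inner_refl hv, inner_refl hv, hpM] at this
  linarith

/-! ### Radial integrals -/

theorem integrableOn_ball_radial {m : ℕ} [Nonempty (Fin m)] (x : E m) (R : ℝ) (φ : ℝ → ℝ) :
    IntegrableOn (fun y => φ (dist x y)) (Metric.ball x R) ↔
      IntegrableOn (fun r => r ^ (m - 1) * φ r) (Ioo 0 R) := by
  have h := integrableOn_fun_norm_addHaar (volume : Measure (E m)) (f := φ) (r := R)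
  rw [finrank_euclideanSpace_fin] at h
  simp only [smul_eq_mul] at h
  rw [← h]
  have h2 := (measurePreserving_sub_right (volume : Measure (E m)) x).integrableOn_comp_preimage
    (MeasurableEquiv.subRight x).measurableEmbedding (f := fun y => φ ‖y‖) (s := Metric.ball 0 R)
  rw [← h2]
  have e1 : (fun y : E m => y - x) ⁻¹' Metric.ball 0 R = Metric.ball x R := by
    ext y; simp [dist_eq_norm]
  rw [e1]
  simp only [Function.comp_def, dist_comm x, dist_eq_norm]

theorem sphereArea_eq {m : ℕ} (hm : 0 < m) :
    sphereArea m = m * volume.real (Metric.ball (0 : E m) 1) := by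
  have : Nonempty (Fin m) := ⟨⟨0, hm⟩⟩
  have hm' : (0 : ℝ) < m := by exact_mod_cast hm
  rw [Measure.real, EuclideanSpace.volume_ball]
  simp only [ENNReal.ofReal_one, one_pow, one_mul, Fintype.card_fin]
  rw [ENNReal.toReal_ofReal (by positivity), Real.Gamma_add_one (by positivity), sphereArea,
    Real.sqrt_eq_rpow, ← Real.rpow_mul_natCast Real.pi_pos.le]
  have := Real.Gamma_pos_of_pos (half_pos hm')
  rw [show (1 : ℝ) / 2 * m = m / 2 by ring]
  field_simp

theorem setIntegral_shell_radial {m : ℕ} (hm : 0 < m) (x : E m) {ε R : ℝ} (hε : 0 < ε)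
    (hR : ε ≤ R) (φ : ℝ → ℝ) :
    ∫ y in Metric.ball x R \ Metric.ball x ε, φ (dist x y) =
      sphereArea m * ∫ r in ε..R, r ^ (m - 1) * φ r := by
  have : Nonempty (Fin m) := ⟨⟨0, hm⟩⟩
  -- The interval is half-open because the shell contains its inner sphere and not its outer one.
  have h := integral_fun_norm_addHaar (volume : Measure (E m)) ((Ico ε R).indicator φ)
  rw [finrank_euclideanSpace_fin, ← integral_sub_right_eq_self _ x] at h
  have e1 : ∀ y, (Ico ε R).indicator φ ‖y - x‖ =
      (Metric.ball x R \ Metric.ball x ε).indicator (fun y => φ (dist x y)) y := by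
    intro y
    simp only [indicator, mem_Ico, Set.mem_sdiff, Metric.mem_ball, not_lt, dist_comm x y,
      dist_eq_norm, and_comm]
  have e2 : ∀ r : ℝ, r ^ (m - 1) • (Ico ε R).indicator φ r =
      (Ico ε R).indicator (fun r => r ^ (m - 1) * φ r) r := by
    intro r
    by_cases hr : r ∈ Ico ε R <;> simp [hr]
  simp only [e1, e2] at h
  rw [integral_indicator (Metric.isOpen_ball.measurableSet.diff Metric.isOpen_ball.measurableSet),
    setIntegral_indicator measurableSet_Ico,
    inter_eq_right.2 (show Ico ε R ⊆ Ioi 0 from fun r hr => hε.trans_le hr.1)] at h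
  rw [h, sphereArea_eq hm, intervalIntegral.integral_of_le hR, integral_Ico_eq_integral_Ioo,
    integral_Ioc_eq_integral_Ioo, nsmul_eq_mul, smul_eq_mul, mul_assoc]

/-- In polar coordinates the integrand is `r ^ (α - 1)` times the sphere area, and `-divergentTerm`
is an antiderivative of it, with the logarithm at `α = 0`. -/
theorem setIntegral_shell_kernel {m : ℕ} (hm : 0 < m) {α : ℝ} (x : E m) {ε R : ℝ}
    (hε : 0 < ε) (hR : ε ≤ R) :
    ∫ y in Metric.ball x R \ Metric.ball x ε, kernel α x y =
      divergentTerm m α ε - divergentTerm m α R := by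
  have hR0 := hε.trans_le hR
  have h0 : (0 : ℝ) ∉ uIcc ε R := by
    rw [uIcc_of_le hR]; exact fun h => h.1.not_gt hε
  have h := setIntegral_shell_radial hm x hε hR (fun r => r ^ (α - (m : ℝ)))
  have e : ∫ r in ε..R, r ^ (m - 1) * r ^ (α - (m : ℝ)) = ∫ r in ε..R, r ^ (α - 1) := by
    refine intervalIntegral.integral_congr fun r hr => ?_
    rw [uIcc_of_le hR] at hr
    have hr0 := hε.trans_le hr.1
    rw [← Real.rpow_natCast, ← Real.rpow_add hr0, Nat.cast_sub hm]
    congr 1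
    push_cast
    ring
  simp only [kernel]
  rw [h, e]
  unfold divergentTerm
  split_ifs with hα
  · subst hα
    simp only [zero_sub, Real.rpow_neg_one]
    rw [integral_inv h0, Real.log_div hR0.ne' hε.ne', one_div, one_div, Real.log_inv, Real.log_inv]
    ring
  · rw [integral_rpow (Or.inr ⟨by simpa [sub_eq_iff_eq_add] using hα, h0⟩), sub_add_cancel,
      Real.rpow_neg hε.le, Real.rpow_neg hR0.le, one_div, one_div, inv_inv, inv_inv]
    field_simp
    ring

theorem integrableOn_radial_of_isCompact {m : ℕ} {K : Set (E m)} (hK : IsCompact K) {x : E m}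
    (hx : x ∉ K) {φ : ℝ → ℝ} (hφ : ContinuousOn φ (Ioi 0)) :
    IntegrableOn (fun y => φ (dist x y)) K := by
  refine ContinuousOn.integrableOn_compact hK (hφ.comp (by fun_prop) fun y hy => ?_)
  exact dist_pos.2 fun h => hx (h ▸ hy)

theorem continuousOn_rpow_Ioi (p : ℝ) : ContinuousOn (fun r : ℝ => r ^ p) (Ioi 0) :=
  fun _ hr => (Real.continuousAt_rpow_const _ _ (Or.inl (ne_of_gt hr))).continuousWithinAt

theorem integrableOn_kernel_diff_ball {m : ℕ} (α : ℝ) {Ω : Set (E m)} (hΩ : IsCompact Ω)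
    (x : E m) {ε : ℝ} (hε : 0 < ε) : IntegrableOn (kernel α x) (Ω \ Metric.ball x ε) :=
  integrableOn_radial_of_isCompact (hΩ.diff Metric.isOpen_ball)
    (fun h => h.2 (Metric.mem_ball_self hε)) (continuousOn_rpow_Ioi _)

theorem integrableOn_kernel_ball {m : ℕ} (hm : 0 < m) {α : ℝ} (hα : 0 < α) (x : E m) (R : ℝ) :
    IntegrableOn (kernel α x) (Metric.ball x R) := by
  have : Nonempty (Fin m) := ⟨⟨0, hm⟩⟩
  refine (integrableOn_ball_radial x R (fun r => r ^ (α - (m : ℝ)))).2 ?_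
  rcases le_or_gt R 0 with hR | hR
  · simp [hR]
  have h := (intervalIntegral.intervalIntegrable_rpow' (a := 0) (b := R)
    (show -1 < α - 1 by linarith))
  rw [intervalIntegrable_iff_integrableOn_Ioo_of_le hR.le] at h
  refine h.congr_fun (fun r hr => ?_) measurableSet_Ioo
  simp only
  rw [← Real.rpow_natCast, ← Real.rpow_add hr.1, Nat.cast_sub hm]
  congr 1
  push_cast
  ring

theorem integrableOn_log_ball {m : ℕ} (hm : 0 < m) (x : E m) (R : ℝ) :
    IntegrableOn (fun y => Real.log (1 / dist x y)) (Metric.ball x R) := by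
  have : Nonempty (Fin m) := ⟨⟨0, hm⟩⟩
  refine (integrableOn_ball_radial x R (fun r => Real.log (1 / r))).2 ?_
  rcases le_or_gt R 0 with hR | hR
  · simp [hR]
  rw [← intervalIntegrable_iff_integrableOn_Ioo_of_le hR.le]
  simp only [one_div, Real.log_inv]
  exact intervalIntegral.intervalIntegrable_log'.neg.continuousOn_mul (by fun_prop)

theorem exists_subset_ball {m : ℕ} {Ω : Set (E m)} (hΩ : IsCompact Ω) (x : E m) :
    ∃ R > 0, Ω ⊆ Metric.ball x R := by
  obtain ⟨R, hR⟩ := hΩ.isBounded.subset_ball_lt 0 x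
  exact ⟨R, hR⟩

/-! ### Existence of the potentials -/

/-- Shrinking the ball from `δ` to `ε` adds a full shell to the integral, and the change of the
divergent term removes exactly that amount. -/
theorem truncatedPotential_eq {m : ℕ} (hm : 0 < m) (α : ℝ) {Ω : Set (E m)} (hΩ : IsCompact Ω)
    {x : E m} {ε δ : ℝ} (hε : 0 < ε) (hεδ : ε ≤ δ) (hδ : Metric.ball x δ ⊆ Ω) :
    truncatedPotential α Ω x ε = truncatedPotential α Ω x δ := by
  have hi := integrableOn_kernel_diff_ball α hΩ x hε
  have hm' : MeasurableSet (Metric.ball x δ \ Metric.ball x ε) :=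
    Metric.isOpen_ball.measurableSet.diff Metric.isOpen_ball.measurableSet
  have h := setIntegral_sdiff hm' hi (sdiff_subset_sdiff_left hδ)
  have e : (Ω \ Metric.ball x ε) \ (Metric.ball x δ \ Metric.ball x ε) = Ω \ Metric.ball x δ := by
    ext y
    have : y ∈ Metric.ball x ε → y ∈ Metric.ball x δ := fun h => Metric.ball_subset_ball hεδ h
    simp only [Set.mem_sdiff]
    tauto
  rw [e, setIntegral_shell_kernel hm x hε hεδ] at h
  simp only [truncatedPotential]
  linarith

theorem tendsto_truncatedPotential {m : ℕ} (hm : 0 < m) (α : ℝ) {Ω : Set (E m)}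
    (hΩ : IsCompact Ω) {x : E m} {δ : ℝ} (hδ0 : 0 < δ) (hδ : Metric.ball x δ ⊆ Ω) :
    Tendsto (truncatedPotential α Ω x) (𝓝[>] 0) (𝓝 (truncatedPotential α Ω x δ)) := by
  refine tendsto_const_nhds.congr' ?_
  filter_upwards [Ioc_mem_nhdsGT hδ0] with ε hε
  exact (truncatedPotential_eq hm α hΩ hε.1 hε.2 hδ).symm

theorem potential_eq_truncatedPotential {m : ℕ} (hm : 0 < m) {α : ℝ} (hα : α ≤ 0)
    {Ω : Set (E m)} (hΩ : IsCompact Ω) {x : E m} {δ : ℝ} (hδ0 : 0 < δ)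
    (hδ : Metric.ball x δ ⊆ Ω) : potential α Ω x = truncatedPotential α Ω x δ := by
  have hx : x ∈ interior Ω :=
    interior_maximal hδ Metric.isOpen_ball (Metric.mem_ball_self hδ0)
  rw [potential, if_pos ⟨hα, hx⟩]
  exact (tendsto_truncatedPotential hm α hΩ hδ0 hδ).limUnder_eq

theorem potential_of_pos {m : ℕ} {α : ℝ} (hα : 0 < α) (Ω : Set (E m)) (x : E m) :
    potential α Ω x = ∫ y in Ω, kernel α x y :=
  if_neg fun h => h.1.not_gt hα

theorem exists_ball_subset_of_mem_interior {m : ℕ} {Ω : Set (E m)} {x : E m}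
    (hx : x ∈ interior Ω) : ∃ δ > 0, Metric.ball x δ ⊆ Ω :=
  Metric.mem_nhds_iff.1 (mem_interior_iff_mem_nhds.1 hx)

theorem integrableOn_kernel {m : ℕ} (hm : 0 < m) {α : ℝ} (hα : 0 < α) {Ω : Set (E m)}
    (hΩ : IsCompact Ω) (x : E m) : IntegrableOn (kernel α x) Ω :=
  let ⟨_, _, hR⟩ := exists_subset_ball hΩ x
  (integrableOn_kernel_ball hm hα x _).mono_set hR

theorem integrableOn_log {m : ℕ} (hm : 0 < m) {Ω : Set (E m)}
    (hΩ : IsCompact Ω) (x : E m) : IntegrableOn (fun y => Real.log (1 / dist x y)) Ω :=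
  let ⟨_, _, hR⟩ := exists_subset_ball hΩ x
  (integrableOn_log_ball hm x _).mono_set hR

theorem potentialsWellDefined {m : ℕ} (hm : 0 < m) (α : ℝ) {Ω : Set (E m)} (hΩ : IsCompact Ω) :
    PotentialsWellDefined α Ω := by
  refine ⟨fun x hx => ?_, fun _ x hx => ⟨fun ε hε => integrableOn_kernel_diff_ball α hΩ x hε, ?_⟩,
    integrableOn_log hm hΩ⟩
  · rcases hx with hα | hx
    · exact integrableOn_kernel hm hα hΩ x
    · exact integrableOn_radial_of_isCompact hΩ hx (continuousOn_rpow_Ioi _)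
  · obtain ⟨δ, hδ0, hδ⟩ := exists_ball_subset_of_mem_interior hx
    exact ⟨_, tendsto_truncatedPotential hm α hΩ hδ0 hδ⟩

/-! ### The integral of a radial kernel over the complement -/

/-- The part of the integral of a radial kernel over a ball around `x` that is missed by `Ω`. -/
def deficit {m : ℕ} (φ : ℝ → ℝ) (R : ℝ) (Ω : Set (E m)) (x : E m) : ENNReal :=
  ∫⁻ y in Metric.ball x R \ Ω, ENNReal.ofReal (φ (dist x y))

/-- Substituting `y = x - z` moves the dependence on `x` out of the singular kernel into the
indicator of the complement of `Ω`. -/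
theorem deficit_eq_lintegral {m : ℕ} (φ : ℝ → ℝ) (R : ℝ) {Ω : Set (E m)} (hΩ : MeasurableSet Ω)
    (x : E m) : deficit φ R Ω x =
      ∫⁻ z, ((fun z => x - z) ⁻¹' Ωᶜ).indicator
        ((Metric.ball 0 R).indicator fun z => ENNReal.ofReal (φ ‖z‖)) z := by
  rw [deficit, ← lintegral_indicator (Metric.isOpen_ball.measurableSet.diff hΩ),
    ← lintegral_sub_left_eq_self _ x]
  refine lintegral_congr fun z => ?_
  by_cases h1 : x - z ∈ Ω <;> by_cases h2 : ‖z‖ < R <;>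
    simp [indicator, h1, h2]

/-- For closed `Ω` the indicator of the complement is lower semicontinuous in the base point for
each fixed `z`; Fatou's lemma carries this over to the integral. -/
theorem lowerSemicontinuous_deficit {m : ℕ} {φ : ℝ → ℝ} (hφ : Measurable φ) (R : ℝ)
    {Ω : Set (E m)} (hΩ : IsClosed Ω) : LowerSemicontinuous (deficit φ R Ω) := by
  set F : E m → E m → ENNReal := fun y => ((fun z => y - z) ⁻¹' Ωᶜ).indicator
    ((Metric.ball 0 R).indicator fun z : E m => ENNReal.ofReal (φ ‖z‖)) with hF
  have heq : deficit φ R Ω = fun x => ∫⁻ z, F x z :=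
    funext fun x => deficit_eq_lintegral φ R hΩ.measurableSet x
  have hmeas : ∀ y : E m, Measurable (F y) := fun y =>
    ((hφ.comp measurable_norm).ennreal_ofReal.indicator Metric.isOpen_ball.measurableSet).indicator
      ((measurable_const.sub measurable_id : Measurable fun z : E m => y - z)
        hΩ.measurableSet.compl)
  have hlim : ∀ x z, F x z ≤ liminf (fun y => F y z) (𝓝 x) := by
    intro x z
    by_cases hz : x - z ∈ Ωᶜ
    · refine le_liminf_of_le (by isBoundedDefault) ?_
      have hc : Continuous fun y : E m => y - z := by fun_prop
      filter_upwards [hc.continuousAt.eventually_mem (hΩ.isOpen_compl.mem_nhds hz)] with y hy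
      simp only [hF]
      rw [indicator_of_mem (s := (fun z => x - z) ⁻¹' Ωᶜ) hz,
        indicator_of_mem (s := (fun z => y - z) ⁻¹' Ωᶜ) hy]
    · have h0 : F x z = 0 := indicator_of_notMem (s := (fun z => x - z) ⁻¹' Ωᶜ) hz _
      rw [h0]
      exact zero_le
  rw [heq, lowerSemicontinuous_iff_le_liminf]
  intro x
  calc ∫⁻ z, F x z ≤ ∫⁻ z, liminf (fun y => F y z) (𝓝 x) := lintegral_mono (hlim x)
    _ ≤ liminf (fun y => ∫⁻ z, F y z) (𝓝 x) := lintegral_liminf_le hmeas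

theorem ae_dist_pos {m : ℕ} [Nonempty (Fin m)] (x : E m) : ∀ᵐ y : E m, 0 < dist x y := by
  have hne : ∀ᵐ y : E m, y ≠ x := by simp [ae_iff]
  filter_upwards [hne] with y hy using dist_pos.2 hy.symm

theorem setIntegral_ball_diff_eq_toReal_deficit {m : ℕ} [Nonempty (Fin m)] {φ : ℝ → ℝ} {R : ℝ}
    (hpos : ∀ r ∈ Ioo 0 R, 0 ≤ φ r) {Ω : Set (E m)} (hΩ : MeasurableSet Ω) (x : E m)
    (hi : IntegrableOn (fun y => φ (dist x y)) (Metric.ball x R \ Ω)) :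
    ∫ y in Metric.ball x R \ Ω, φ (dist x y) = (deficit φ R Ω x).toReal := by
  refine integral_eq_lintegral_of_nonneg_ae ?_ hi.aestronglyMeasurable
  filter_upwards [ae_restrict_of_ae (ae_dist_pos x),
    ae_restrict_mem (Metric.isOpen_ball.measurableSet.diff hΩ)] with y hy h
  exact hpos _ ⟨hy, by simpa [dist_comm] using h.1⟩

theorem deficit_ne_top {m : ℕ} {φ : ℝ → ℝ} {R : ℝ} {Ω : Set (E m)} {x : E m}
    (hi : IntegrableOn (fun y => φ (dist x y)) (Metric.ball x R \ Ω)) : deficit φ R Ω x ≠ ⊤ :=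
  hi.lintegral_lt_top.ne

theorem setIntegral_ball_radial {m : ℕ} (φ : ℝ → ℝ) (R : ℝ) (x : E m) :
    ∫ y in Metric.ball x R, φ (dist x y) = ∫ y in Metric.ball (0 : E m) R, φ (dist 0 y) := by
  have h := (measurePreserving_sub_right (volume : Measure (E m)) x).setIntegral_preimage_emb
    (MeasurableEquiv.subRight x).measurableEmbedding (fun y => φ (dist 0 y)) (Metric.ball 0 R)
  have e1 : (fun y : E m => y - x) ⁻¹' Metric.ball 0 R = Metric.ball x R := by
    ext y; simp [dist_eq_norm]
  rw [e1] at h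
  rw [← h]
  simp only [dist_comm x, dist_eq_norm, zero_sub, norm_neg]

/-! ### Maximum points for integrable radial kernels -/

/-- On a compact ball of base points the potential is a constant minus a deficit, so a minimum point
of the deficit is a maximum point there. -/
theorem exists_forall_setIntegral_radial_le {m : ℕ} [Nonempty (Fin m)] {φ : ℝ → ℝ}
    (hφ : Measurable φ) (hanti : AntitoneOn φ (Ioi 0))
    (hint : ∀ (x : E m) (R : ℝ), IntegrableOn (fun y => φ (dist x y)) (Metric.ball x R))
    {Ω : Set (E m)} (hΩ : IsCompact Ω) :
    ∃ x, ∀ y, ∫ z in Ω, φ (dist y z) ≤ ∫ z in Ω, φ (dist x z) := by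
  have hmΩ := hΩ.measurableSet
  obtain ⟨r, hr, hrΩ⟩ := exists_subset_ball hΩ 0
  -- With `Ω` inside the ball of radius `r`, radius `3 * r` around any base point of norm at most `2
  -- * r` covers `Ω`. Subtracting `φ R` makes the kernel nonnegative up to that radius, as the
  -- deficit requires.
  set R := 3 * r with hR
  set ψ : ℝ → ℝ := fun t => φ t - φ R with hψ
  have hψi : ∀ (x : E m), IntegrableOn (fun y => ψ (dist x y)) (Metric.ball x R) := fun x =>
    (hint x R).sub (integrableOn_const (measure_ball_lt_top.ne))
  have hψpos : ∀ t ∈ Ioo 0 R, 0 ≤ ψ t := fun t ht =>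
    sub_nonneg.2 (hanti ht.1 (ht.1.trans ht.2) ht.2.le)
  have hi : ∀ x, IntegrableOn (fun y => φ (dist x y)) Ω := fun x =>
    let ⟨S, _, hS⟩ := exists_subset_ball hΩ x
    (hint x S).mono_set hS
  have hrep : ∀ x ∈ Metric.closedBall (0 : E m) (2 * r), ∫ z in Ω, φ (dist x z) =
      (∫ y in Metric.ball (0 : E m) R, ψ (dist 0 y)) + volume.real Ω * φ R -
        (deficit ψ R Ω x).toReal := by
    intro x hx
    have hsub : Ω ⊆ Metric.ball x R := fun y hy => by
      have h1 := Metric.mem_ball.1 (hrΩ hy)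
      have h2 := Metric.mem_closedBall.1 hx
      have h3 := dist_triangle_right y x 0
      rw [Metric.mem_ball]
      linarith
    have h := setIntegral_sdiff hmΩ (hψi x) hsub
    rw [setIntegral_ball_diff_eq_toReal_deficit hψpos hmΩ x
      ((hψi x).mono_set sdiff_subset), setIntegral_ball_radial] at h
    have h' : ∫ z in Ω, ψ (dist x z) = (∫ z in Ω, φ (dist x z)) - volume.real Ω * φ R := by
      rw [hψ, integral_sub (hi x) (integrableOn_const hΩ.measure_lt_top.ne), setIntegral_const,
        smul_eq_mul]
    linarith
  obtain ⟨x, hx, hmin⟩ := ((lowerSemicontinuous_deficit (hφ.sub_const (φ R)) R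
    hΩ.isClosed).lowerSemicontinuousOn _).exists_isMinOn
      (Metric.nonempty_closedBall.2 (by positivity)) (isCompact_closedBall (0 : E m) (2 * r))
  have hD : ∀ y ∈ Metric.closedBall (0 : E m) (2 * r),
      ∫ z in Ω, φ (dist y z) ≤ ∫ z in Ω, φ (dist x z) := by
    intro y hy
    rw [hrep y hy, hrep x hx]
    exact sub_le_sub_left (ENNReal.toReal_mono
      (deficit_ne_top ((hψi y).mono_set sdiff_subset)) (hmin hy)) _
  refine ⟨x, fun y => ?_⟩
  by_cases hy : y ∈ Metric.closedBall (0 : E m) (2 * r)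
  · exact hD y hy
  -- A base point of norm above `2 * r` is farther than `r` from every point of `Ω`, whereas the
  -- origin is within `r` of all of them.
  · refine le_trans ?_ (hD 0 (Metric.mem_closedBall_self (by positivity)))
    refine integral_mono_ae (hi y) (hi 0) ?_
    filter_upwards [ae_restrict_of_ae (ae_dist_pos (0 : E m)), ae_restrict_mem hmΩ] with z hz hzΩ
    have h1 := Metric.mem_ball'.1 (hrΩ hzΩ)
    have h2 := not_le.1 (fun h => hy (Metric.mem_closedBall.2 h))
    have h3 := dist_triangle_right y 0 z
    have : dist 0 z ≤ dist y z := by linarith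
    exact hanti hz (hz.trans_le this) this

/-! ### Divergence over a cone -/

theorem isOpen_cone {m : ℕ} {u : E m} (hu : u ≠ 0) (θ : ℝ) :
    IsOpen {w : E m | w ≠ 0 ∧ InnerProductGeometry.angle w u < θ} := by
  have hc : ContinuousOn (fun w : E m => InnerProductGeometry.angle w u) {w | w ≠ 0} :=
    fun w hw => ((InnerProductGeometry.continuousAt_angle (x := (w, u)) hw hu).comp
      (f := fun w : E m => (w, u)) (by fun_prop)).continuousWithinAt
  exact hc.isOpen_inter_preimage isOpen_ne isOpen_Iio

/-- The measure `|w| ^ (-m) dw` is invariant under dilations, and so is the cone. -/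
theorem lintegral_rpow_cone_scale {m : ℕ} {K : Set (E m)} (hK : MeasurableSet K)
    (hK2 : ∀ w, (2 : ℝ) • w ∈ K ↔ w ∈ K) (δ : ℝ) :
    ∫⁻ w in K ∩ Metric.ball 0 (δ / 2), ENNReal.ofReal (‖w‖ ^ (-(m : ℝ))) =
      ∫⁻ w in K ∩ Metric.ball 0 δ, ENNReal.ofReal (‖w‖ ^ (-(m : ℝ))) := by
  have hm1 : ∀ r, MeasurableSet (K ∩ Metric.ball 0 r) := fun r =>
    hK.inter Metric.isOpen_ball.measurableSet
  have hmeas : Measurable fun w : E m => ENNReal.ofReal (‖w‖ ^ (-(m : ℝ))) := by fun_prop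
  set c : ENNReal := ENNReal.ofReal ((2 : ℝ) ^ (-(m : ℝ))) with hc
  have hc0 : c ≠ 0 := by rw [hc]; simp
  have hct : c ≠ ⊤ := ENNReal.ofReal_ne_top
  have h := Measure.map_addHaar_smul (volume : Measure (E m)) (r := 2) two_ne_zero
  have hcoef : ENNReal.ofReal |((2 : ℝ) ^ Module.finrank ℝ (E m))⁻¹| = c := by
    rw [finrank_euclideanSpace_fin, abs_of_pos (by positivity), hc, Real.rpow_neg two_pos.le,
      Real.rpow_natCast]
  rw [hcoef] at h
  have h1 : ∫⁻ w, (K ∩ Metric.ball 0 δ).indicator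
      (fun w => ENNReal.ofReal (‖w‖ ^ (-(m : ℝ)))) ((2 : ℝ) • w) =
      c * ∫⁻ w in K ∩ Metric.ball 0 δ, ENNReal.ofReal (‖w‖ ^ (-(m : ℝ))) := by
    rw [← lintegral_map (hmeas.indicator (hm1 δ)) (measurable_const_smul 2), h,
      lintegral_smul_measure, lintegral_indicator (hm1 δ), smul_eq_mul]
  have h2 : ∀ w : E m, (K ∩ Metric.ball 0 δ).indicator
      (fun w => ENNReal.ofReal (‖w‖ ^ (-(m : ℝ)))) ((2 : ℝ) • w) =
      c * (K ∩ Metric.ball 0 (δ / 2)).indicator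
        (fun w => ENNReal.ofReal (‖w‖ ^ (-(m : ℝ)))) w := by
    intro w
    have hiff : (2 : ℝ) • w ∈ K ∩ Metric.ball 0 δ ↔ w ∈ K ∩ Metric.ball 0 (δ / 2) := by
      simp only [mem_inter_iff, hK2, mem_ball_zero_iff, norm_smul, Real.norm_two,
        lt_div_iff₀' (two_pos : (0 : ℝ) < 2)]
    by_cases hw : w ∈ K ∩ Metric.ball 0 (δ / 2)
    · rw [indicator_of_mem hw, indicator_of_mem (hiff.2 hw), norm_smul, Real.norm_two,
        Real.mul_rpow two_pos.le (norm_nonneg w), ENNReal.ofReal_mul (by positivity)]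
    · rw [indicator_of_notMem hw, indicator_of_notMem (fun h => hw (hiff.1 h)), mul_zero]
  simp only [h2] at h1
  rw [lintegral_const_mul _ (hmeas.indicator (hm1 _)), lintegral_indicator (hm1 _)] at h1
  exact (ENNReal.mul_right_inj hc0 hct).1 h1

/-- If the integral were finite, scale invariance would force the part between radii `δ / 2` and `δ`
to vanish, yet this part contains a non-empty open set on which the integrand is bounded below. -/
theorem lintegral_rpow_cone_eq_top {m : ℕ} {u : E m} (hu : ‖u‖ = 1) {θ δ : ℝ} (hθ : 0 < θ)
    (hδ : 0 < δ) :
    ∫⁻ w in {w : E m | w ≠ 0 ∧ InnerProductGeometry.angle w u < θ} ∩ Metric.ball 0 δ,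
      ENNReal.ofReal (‖w‖ ^ (-(m : ℝ))) = ⊤ := by
  have hu0 : u ≠ 0 := fun h => by simp [h] at hu
  have hKo := isOpen_cone hu0 θ
  set K := {w : E m | w ≠ 0 ∧ InnerProductGeometry.angle w u < θ}
  have hK2 : ∀ w, (2 : ℝ) • w ∈ K ↔ w ∈ K := fun w => by
    simp [K, InnerProductGeometry.angle_smul_left_of_pos]
  by_contra hfin
  have hscale := lintegral_rpow_cone_scale hKo.measurableSet hK2 δ
  have hsub : K ∩ Metric.ball 0 (δ / 2) ⊆ K ∩ Metric.ball 0 δ :=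
    inter_subset_inter_right _ (Metric.ball_subset_ball (by linarith))
  have hsplit := lintegral_inter_add_sdiff (μ := volume)
    (fun w : E m => ENNReal.ofReal (‖w‖ ^ (-(m : ℝ)))) (K ∩ Metric.ball 0 δ)
    (hKo.inter (Metric.isOpen_ball (x := (0 : E m)) (ε := δ / 2))).measurableSet
  rw [inter_eq_right.2 hsub, hscale] at hsplit
  have hzero : ∫⁻ w in (K ∩ Metric.ball 0 δ) \ (K ∩ Metric.ball 0 (δ / 2)),
      ENNReal.ofReal (‖w‖ ^ (-(m : ℝ))) = 0 := by
    have := hsplit.trans (add_zero _).symm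
    exact (ENNReal.add_right_inj hfin).1 this
  set S : Set (E m) := K ∩ Metric.ball 0 δ ∩ {w | δ / 2 < ‖w‖} with hS
  have hSo : IsOpen S :=
    (hKo.inter Metric.isOpen_ball).inter (isOpen_lt continuous_const continuous_norm)
  have hSsub : S ⊆ (K ∩ Metric.ball 0 δ) \ (K ∩ Metric.ball 0 (δ / 2)) := fun w hw =>
    ⟨hw.1, fun h => (mem_ball_zero_iff.1 h.2).not_gt hw.2⟩
  have hSne : S.Nonempty := by
    refine ⟨(3 / 4 * δ) • u, ⟨⟨?_, ?_⟩, ?_⟩, ?_⟩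
    · exact smul_ne_zero (by positivity) hu0
    · rw [InnerProductGeometry.angle_smul_left_of_pos _ _ (by positivity),
        InnerProductGeometry.angle_self hu0]
      exact hθ
    · rw [mem_ball_zero_iff, norm_smul, hu, Real.norm_of_nonneg (by positivity)]
      linarith
    · change δ / 2 < _
      rw [norm_smul, hu, Real.norm_of_nonneg (by positivity)]
      linarith
  have hlow : ENNReal.ofReal (δ ^ (-(m : ℝ))) * volume S ≤ 0 := by
    rw [← hzero, ← setLIntegral_const]
    refine (setLIntegral_mono' hSo.measurableSet fun w hw => ?_).trans (lintegral_mono_set hSsub)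
    refine ENNReal.ofReal_le_ofReal (Real.rpow_le_rpow_of_nonpos ?_ ?_ (by simp))
    · exact norm_pos_iff.2 hw.1.1.1
    · exact (mem_ball_zero_iff.1 hw.1.2).le
  refine hlow.not_gt (ENNReal.mul_pos ?_ (hSo.measure_pos volume hSne).ne')
  simp
  positivity

theorem deficit_eq_top_of_truncatedCone_subset {m : ℕ} {α : ℝ} (hα : α ≤ 0) {R : ℝ} (hR : 0 < R)
    {Ω : Set (E m)} (hΩ : MeasurableSet Ω) {z u : E m} {ε θ : ℝ} (hε : 0 < ε) (hθ : 0 < θ)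
    (hu : ‖u‖ = 1) (hcone : truncatedCone z u ε θ ⊆ Ωᶜ) :
    deficit (fun r => r ^ (α - (m : ℝ))) R Ω z = ⊤ := by
  have hu0 : u ≠ 0 := fun h => by simp [h] at hu
  -- The bound by `1` ensures `r ^ (α - m) ≥ r ^ (-m)` for `α ≤ 0`.
  set δ := min (min ε R) 1 with hδ
  have hδ0 : 0 < δ := by positivity
  have hδε : δ ≤ ε := (min_le_left _ _).trans (min_le_left _ _)
  have hδR : δ ≤ R := (min_le_left _ _).trans (min_le_right _ _)
  have hδ1 : δ ≤ 1 := min_le_right _ _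
  set K := {w : E m | w ≠ 0 ∧ InnerProductGeometry.angle w u < θ} with hK
  have hmK : MeasurableSet (K ∩ Metric.ball 0 δ) :=
    ((isOpen_cone hu0 θ).inter Metric.isOpen_ball).measurableSet
  have hd : deficit (fun r => r ^ (α - (m : ℝ))) R Ω z =
      ∫⁻ w, (Metric.ball z R \ Ω).indicator
        (fun y => ENNReal.ofReal (dist z y ^ (α - (m : ℝ)))) (z + w) := by
    rw [lintegral_add_left_eq_self
      ((Metric.ball z R \ Ω).indicator fun y => ENNReal.ofReal (dist z y ^ (α - (m : ℝ)))) z,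
      lintegral_indicator (Metric.isOpen_ball.measurableSet.diff hΩ), deficit]
  rw [hd, eq_top_iff, ← lintegral_rpow_cone_eq_top hu hθ hδ0, ← lintegral_indicator hmK]
  refine lintegral_mono fun w => ?_
  by_cases hw : w ∈ K ∩ Metric.ball 0 δ
  · have hw0 : 0 < ‖w‖ := norm_pos_iff.2 hw.1.1
    have hwδ : ‖w‖ < δ := mem_ball_zero_iff.1 hw.2
    have hmem : z + w ∈ Metric.ball z R \ Ω := by
      refine ⟨by simpa using hwδ.trans_le hδR, hcone ⟨?_, ?_, ?_⟩⟩
      · simpa using hw.1.1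
      · simpa using hwδ.trans_le hδε
      · simpa using hw.1.2
    rw [indicator_of_mem hw, indicator_of_mem hmem, dist_self_add_right]
    exact ENNReal.ofReal_le_ofReal
      (Real.rpow_le_rpow_of_exponent_ge hw0 (hwδ.le.trans hδ1) (by linarith))
  · rw [indicator_of_notMem hw]
    exact zero_le

/-! ### Maximum points of the renormalized potential -/

/-- Removing `Ω` from the shell between a small ball inside `Ω` and the ball of radius `2 * R`
leaves the deficit region; the divergent terms at the small radius cancel. -/
theorem potential_eq_sub_toReal_deficit {m : ℕ} (hm : 0 < m) {α : ℝ} (hα : α ≤ 0)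
    {Ω : Set (E m)} (hΩ : IsCompact Ω) {x : E m} (hx : x ∈ interior Ω) {R : ℝ}
    (hR : Metric.closedBall x R ⊇ Ω) (hR0 : 0 < R) :
    potential α Ω x = -divergentTerm m α (2 * R) -
        (deficit (fun r => r ^ (α - (m : ℝ))) (2 * R) Ω x).toReal ∧
      deficit (fun r => r ^ (α - (m : ℝ))) (2 * R) Ω x ≠ ⊤ := by
  have : Nonempty (Fin m) := ⟨⟨0, hm⟩⟩
  have hmΩ := hΩ.measurableSet
  have hΩR : Ω ⊆ Metric.ball x (2 * R) := hR.trans (Metric.closedBall_subset_ball (by linarith))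
  obtain ⟨δ', hδ'0, hδ'⟩ := exists_ball_subset_of_mem_interior hx
  obtain ⟨δ, hδ0, hδR, hδδ'⟩ : ∃ δ, 0 < δ ∧ δ ≤ 2 * R ∧ δ ≤ δ' :=
    ⟨min (2 * R) δ', by positivity, min_le_left _ _, min_le_right _ _⟩
  have hδ : Metric.ball x δ ⊆ Ω := (Metric.ball_subset_ball hδδ').trans hδ'
  have hshell : IntegrableOn (kernel α x) (Metric.ball x (2 * R) \ Metric.ball x δ) :=
    (integrableOn_kernel_diff_ball α (isCompact_closedBall x (2 * R)) x hδ0).mono_set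
      (sdiff_subset_sdiff_left Metric.ball_subset_closedBall)
  have hout : IntegrableOn (kernel α x) (Metric.ball x (2 * R) \ Ω) :=
    hshell.mono_set (sdiff_subset_sdiff_right hδ)
  refine ⟨?_, deficit_ne_top hout⟩
  have hpos : ∀ r ∈ Ioo 0 (2 * R), 0 ≤ (fun r : ℝ => r ^ (α - (m : ℝ))) r := fun r hr =>
    Real.rpow_nonneg hr.1.le _
  have h := setIntegral_sdiff (hmΩ.diff Metric.isOpen_ball.measurableSet) hshell
    (sdiff_subset_sdiff_left (t := Metric.ball x δ) hΩR)
  have e : (Metric.ball x (2 * R) \ Metric.ball x δ) \ (Ω \ Metric.ball x δ) =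
      Metric.ball x (2 * R) \ Ω := by
    ext y
    have := @hδ y
    simp only [Set.mem_sdiff]
    tauto
  rw [e, setIntegral_shell_kernel hm x hδ0 hδR] at h
  rw [potential_eq_truncatedPotential hm hα hΩ hδ0 hδ, truncatedPotential,
    ← setIntegral_ball_diff_eq_toReal_deficit hpos hmΩ x hout]
  simp only [kernel] at h ⊢
  linarith

theorem exists_forall_potential_le_of_nonpos {m : ℕ} (hm : 0 < m) {α : ℝ} (hα : α ≤ 0)
    {Ω : Set (E m)} (hΩ : IsBody Ω) (hne : Ω.Nonempty) (hcone : OuterConeCondition Ω) :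
    ∃ x ∈ interior Ω, ∀ y ∈ interior Ω, potential α Ω y ≤ potential α Ω x := by
  obtain ⟨y₀, hy₀⟩ : (interior Ω).Nonempty := by
    rw [← closure_nonempty_iff, hΩ.2]
    exact hne
  -- One radius serves all interior points, so their potentials differ only by their deficits;
  -- adding `1` makes it positive.
  set R := Metric.diam Ω + 1 with hR
  have hR0 : 0 < R := by have := Metric.diam_nonneg (s := Ω); linarith
  have hsub : ∀ x ∈ interior Ω, Metric.closedBall x R ⊇ Ω := fun x hx y hy => by
    have := Metric.dist_le_diam_of_mem hΩ.1.isBounded hy (interior_subset hx)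
    exact Metric.mem_closedBall.2 (by linarith)
  have hrep := fun x hx => potential_eq_sub_toReal_deficit hm hα hΩ.1 hx (hsub x hx) hR0
  -- The minimum is taken over all of `Ω`, which is compact, and boundary points are excluded
  -- afterwards because the outer cone makes their deficit infinite.
  obtain ⟨x, hx, hmin⟩ := ((lowerSemicontinuous_deficit
    (by fun_prop : Measurable fun r : ℝ => r ^ (α - (m : ℝ))) (2 * R)
    hΩ.1.isClosed).lowerSemicontinuousOn _).exists_isMinOn hne hΩ.1
  have hxi : x ∈ interior Ω := by
    by_contra hn
    obtain ⟨ε, hε, θ, hθ, u, hu, hc⟩ := hcone x ⟨subset_closure hx, hn⟩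
    have h := deficit_eq_top_of_truncatedCone_subset hα (R := 2 * R) (by positivity)
      hΩ.1.measurableSet hε hθ hu hc
    have h' := hmin (interior_subset hy₀)
    rw [mem_ofPred_eq, h, top_le_iff] at h'
    exact (hrep y₀ hy₀).2 h'
  refine ⟨x, hxi, fun y hy => ?_⟩
  rw [(hrep x hxi).1, (hrep y hy).1]
  exact sub_le_sub_left (ENNReal.toReal_mono (hrep y hy).2 (hmin (interior_subset hy))) _

/-! ### Existence of centers -/

theorem exists_isCenter {m : ℕ} (hm : 0 < m) {α : ℝ} {Ω : Set (E m)} (hΩ : IsBody Ω)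
    (hne : Ω.Nonempty) (hcone : α ≤ 0 → OuterConeCondition Ω) : ∃ x, IsCenter α Ω x := by
  have : Nonempty (Fin m) := ⟨⟨0, hm⟩⟩
  rcases le_or_gt α 0 with hα | hα
  · obtain ⟨x, hx, hmax⟩ := exists_forall_potential_le_of_nonpos hm hα hΩ hne (hcone hα)
    have hm' : (0 : ℝ) < m := by exact_mod_cast hm
    exact ⟨x, fun h => by linarith, fun h => by linarith, fun h => by linarith,
      fun _ => ⟨hx, hmax⟩⟩
  rcases lt_trichotomy α m with h | h | h
  · obtain ⟨x, hx⟩ := exists_forall_setIntegral_radial_le (m := m) (φ := fun r => r ^ (α - (m : ℝ)))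
      (by fun_prop)
      (fun r hr s _ hrs => Real.rpow_le_rpow_of_nonpos hr hrs (by linarith))
      (integrableOn_kernel_ball hm hα) hΩ.1
    refine ⟨x, fun _ => by linarith, fun _ => by linarith, fun _ _ y => ?_, fun _ => by linarith⟩
    rw [potential_of_pos hα, potential_of_pos hα]
    exact hx y
  · obtain ⟨x, hx⟩ := exists_forall_setIntegral_radial_le (m := m) (φ := fun r => Real.log (1 / r))
      (by fun_prop)
      (fun r hr s _ hrs => by
        have hr' : (0 : ℝ) < r := hr
        exact Real.log_le_log (by have := hr'.trans_le hrs; positivity)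
          (one_div_le_one_div_of_le hr' hrs))
      (integrableOn_log_ball hm) hΩ.1
    exact ⟨x, fun _ => by linarith, fun _ => hx, fun _ _ => by linarith, fun _ => by linarith⟩
  -- For `α > m` the kernel increases with distance; its negative is decreasing and turns the
  -- minimum into a maximum.
  · obtain ⟨x, hx⟩ := exists_forall_setIntegral_radial_le (m := m)
      (φ := fun r => -r ^ (α - (m : ℝ))) (by fun_prop)
      (fun r hr s _ hrs => neg_le_neg (Real.rpow_le_rpow (le_of_lt hr) hrs (by linarith)))
      (fun x R => (integrableOn_kernel_ball hm hα x R).neg) hΩ.1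
    refine ⟨x, fun _ y => ?_, fun _ => by linarith, fun _ _ => by linarith, fun _ => by linarith⟩
    rw [potential_of_pos hα, potential_of_pos hα]
    have h := hx y
    simp only [integral_neg] at h
    exact neg_le_neg_iff.1 h

/-! ### Centers lie in the minimal unfolded region -/

theorem setIntegral_lt_setIntegral_refl {m : ℕ} [Nonempty (Fin m)] {φ : ℝ → ℝ}
    (hφ : StrictAntiOn φ (Ioi 0)) {Ω : Set (E m)} (hΩ : MeasurableSet Ω)
    (hi : ∀ x, IntegrableOn (fun y => φ (dist x y)) Ω) {v : E m} (hv : ‖v‖ = 1) {b : ℝ} {x : E m}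
    (hb : b < inner ℝ x v) (hfold : refl v b '' cap Ω v b ⊆ Ω)
    (hpos : 0 < volume (foldRemainder Ω v b ∩ {y | inner ℝ y v < b})) :
    ∫ y in Ω, φ (dist x y) < ∫ y in Ω, φ (dist (refl v b x) y) := by
  rw [← sub_pos, setIntegral_refl_sub_setIntegral hΩ hv hfold x φ (hi _) (hi _)]
  exact setIntegral_foldRemainder_pos hΩ hv hb hφ hpos
    (((hi _).sub (hi _)).mono_set (foldRemainder_subset Ω v b))

theorem strictAntiOn_rpow {p : ℝ} (hp : p < 0) : StrictAntiOn (fun r : ℝ => r ^ p) (Ioi 0) :=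
  fun _ hr _ _ hrs => Real.rpow_lt_rpow_of_neg hr hrs hp

theorem refl_mem_interior {m : ℕ} {Ω : Set (E m)} {v : E m} (hv : ‖v‖ = 1) {b : ℝ} {x : E m}
    (hx : x ∈ interior Ω) (hb : b < inner ℝ x v) (hfold : refl v b '' cap Ω v b ⊆ Ω) :
    refl v b x ∈ interior Ω := by
  have ho : IsOpen (interior Ω ∩ {y | b < inner ℝ y v}) :=
    isOpen_interior.inter (isOpen_lt (by fun_prop) (by fun_prop))
  refine mem_interior.2 ⟨_, ?_, (reflHomeomorph v hv b).isOpenMap _ ho, x, ⟨hx, hb⟩, rfl⟩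
  exact (image_mono fun y hy => ⟨interior_subset hy.1, hy.2⟩ : _ ⊆ refl v b '' cap Ω v b).trans hfold

/-- A ball around `x` inside the cap and its mirror image both lie in `Ω`, so both potentials can be
truncated at the same radius `δ` with the same divergent term. -/
theorem potential_lt_potential_refl {m : ℕ} (hm : 0 < m) {α : ℝ} (hα : α ≤ 0) {Ω : Set (E m)}
    (hΩ : IsCompact Ω) {v : E m} (hv : ‖v‖ = 1) {b : ℝ} {x : E m}
    (hx : x ∈ interior Ω) (hb : b < inner ℝ x v) (hfold : refl v b '' cap Ω v b ⊆ Ω)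
    (hpos : 0 < volume (foldRemainder Ω v b ∩ {y | inner ℝ y v < b})) :
    potential α Ω x < potential α Ω (refl v b x) := by
  have : Nonempty (Fin m) := ⟨⟨0, hm⟩⟩
  have hm' : (0 : ℝ) < m := by exact_mod_cast hm
  have hmΩ := hΩ.measurableSet
  have ho : IsOpen (interior Ω ∩ {y | b < inner ℝ y v}) :=
    isOpen_interior.inter (isOpen_lt (by fun_prop) (by fun_prop))
  obtain ⟨δ, hδ0, hδ⟩ := Metric.isOpen_iff.1 ho x ⟨hx, hb⟩
  have hδcap : Metric.ball x δ ⊆ cap Ω v b := fun y hy => ⟨interior_subset (hδ hy).1, (hδ hy).2⟩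
  have hδ' : Metric.ball (refl v b x) δ ⊆ refl v b '' cap Ω v b := fun y hy =>
    ⟨refl v b y, hδcap (by rwa [Metric.mem_ball', ← dist_refl_left hv, ← Metric.mem_ball']),
      refl_refl hv b y⟩
  -- The cutoff kernel is integrable over `Ω` but not monotone. It serves only for the cancellation
  -- of the symmetric part; strict positivity comes from the uncut kernel, which agrees with it on
  -- the remainder.
  set φ : ℝ → ℝ := (Ici δ).indicator fun r => r ^ (α - (m : ℝ)) with hφ
  have hind : ∀ z : E m, (fun y => φ (dist z y)) =
      (Metric.ball z δ)ᶜ.indicator (kernel α z) := fun z => by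
    ext y
    simp only [hφ, indicator, mem_Ici, mem_compl_iff, Metric.mem_ball', not_lt, kernel]
  have hi : ∀ z, IntegrableOn (fun y => φ (dist z y)) Ω := fun z => by
    rw [hind, IntegrableOn, integrable_indicator_iff Metric.isOpen_ball.measurableSet.compl,
      IntegrableOn, Measure.restrict_restrict Metric.isOpen_ball.measurableSet.compl, inter_comm]
    exact integrableOn_kernel_diff_ball α hΩ z hδ0
  have hval : ∀ z, Metric.ball z δ ⊆ Ω →
      potential α Ω z = (∫ y in Ω, φ (dist z y)) - divergentTerm m α δ := fun z hz => by
    rw [potential_eq_truncatedPotential hm hα hΩ hδ0 hz, truncatedPotential, hind,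
      setIntegral_indicator Metric.isOpen_ball.measurableSet.compl, sdiff_eq]
  rw [hval x fun y hy => (hδcap hy).1, hval _ (hδ'.trans hfold), sub_lt_sub_iff_right, ← sub_pos,
    setIntegral_refl_sub_setIntegral hmΩ hv hfold x φ (hi _) (hi _)]
  have hcongr : EqOn (fun y => φ (dist (refl v b x) y) - φ (dist x y))
      (fun y => dist (refl v b x) y ^ (α - (m : ℝ)) - dist x y ^ (α - (m : ℝ)))
      (foldRemainder Ω v b) := fun y hy => by
    -- A point nearer than `δ` would be the mirror image of a cap point, which the remainder
    -- excludes.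
    have h1 : δ ≤ dist (refl v b x) y := by
      by_contra! h
      obtain ⟨w, hw, rfl⟩ := hδ' (Metric.mem_ball'.2 h)
      exact hy.2.2 (by rwa [refl_refl hv])
    have h2 := h1.trans (dist_refl_left_le hv hb hy.2.1)
    simp only [hφ]
    rw [indicator_of_mem (mem_Ici.2 h1), indicator_of_mem (mem_Ici.2 h2)]
  have hmR := measurableSet_foldRemainder hmΩ v b
  rw [setIntegral_congr_fun hmR hcongr]
  exact setIntegral_foldRemainder_pos hmΩ hv hb (strictAntiOn_rpow (by linarith)) hpos
    ((((hi _).sub (hi _)).mono_set (foldRemainder_subset Ω v b)).congr_fun hcongr hmR)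

theorem IsCenter.mem_minimalUnfoldedRegion {m : ℕ} (hm : 0 < m) {α : ℝ} {Ω : Set (E m)}
    (hΩ : IsBody Ω) (hne : Ω.Nonempty) {x : E m} (hx : IsCenter α Ω x) :
    x ∈ minimalUnfoldedRegion Ω := by
  have : Nonempty (Fin m) := ⟨⟨0, hm⟩⟩
  have hmΩ := hΩ.1.measurableSet
  intro v hv
  by_contra! hlt
  obtain ⟨b, hb, hfold, hpos⟩ := exists_fold_of_foldingLevel_lt hΩ hne hv hlt
  rcases le_or_gt α 0 with hα | hα
  · obtain ⟨hxi, hmax⟩ := hx.of_nonpos hα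
    exact (hmax _ (refl_mem_interior hv hxi hb hfold)).not_gt
      (potential_lt_potential_refl hm hα hΩ.1 hv hxi hb hfold hpos)
  rcases lt_trichotomy α m with h | h | h
  · have hle := hx.of_lt hα h (refl v b x)
    rw [potential_of_pos hα, potential_of_pos hα] at hle
    exact hle.not_gt (setIntegral_lt_setIntegral_refl (strictAntiOn_rpow (by linarith)) hmΩ
      (integrableOn_kernel hm hα hΩ.1) hv hb hfold hpos)
  · refine (hx.of_eq h (refl v b x)).not_gt (setIntegral_lt_setIntegral_refl
      (φ := fun r => Real.log (1 / r)) (fun r hr s hs hrs => ?_) hmΩ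
      (integrableOn_log hm hΩ.1) hv hb hfold hpos)
    exact Real.log_lt_log (one_div_pos.2 hs) (one_div_lt_one_div_of_lt hr hrs)
  · have hle := hx.of_gt h (refl v b x)
    rw [potential_of_pos hα, potential_of_pos hα] at hle
    have hlt := setIntegral_lt_setIntegral_refl (φ := fun r => -r ^ (α - (m : ℝ)))
      (fun r hr s _ hrs => neg_lt_neg (Real.rpow_lt_rpow (le_of_lt hr) hrs (by linarith))) hmΩ
      (fun z => (integrableOn_kernel hm hα hΩ.1 z).neg) hv hb hfold hpos
    simp only [integral_neg] at hlt
    exact hle.not_gt (neg_lt_neg_iff.1 hlt)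

end RieszCenter

end

theorem mainTheorem1 (m : ℕ) (hm : 2 ≤ m) (Ω : Set (RieszCenter.E m))
    (hne : Ω.Nonempty) (hbody : RieszCenter.IsBody Ω)
    (hC1 : RieszCenter.HasPiecewiseC1Boundary Ω) (α : ℝ) :
    RieszCenter.PotentialsWellDefined α Ω ∧
    ((α ≤ 0 → RieszCenter.OuterConeCondition Ω) → ∃ x, RieszCenter.IsCenter α Ω x) ∧
    ∀ x, RieszCenter.IsCenter α Ω x → x ∈ RieszCenter.minimalUnfoldedRegion Ω := by
  have hm0 : 0 < m := by lia
  exact ⟨RieszCenter.potentialsWellDefined hm0 α hbody.1,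
    RieszCenter.exists_isCenter hm0 hbody hne,
    fun _ hx => hx.mem_minimalUnfoldedRegion hm0 hbody hne⟩
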